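/- Let $f\in\mathbb{Q}[z]$ be a polynomial of odd degree $d\ge 3$ that is unicritical, i.e. its derivative $f'$ has exactly one root in $\overline{\mathbb{Q}}$. For a field $F\supseteq\mathbb{Q}$ and $a\in F$, let $T_a=\bigsqcup_{n\ge 0}f^{-n}(a)$ be the tree of iterated preimages of $a$ in a separable closure $F^{\mathrm{sep}}$: the vertices of level $n$ are the $x\in F^{\mathrm{sep}}$ with $f^n(x)=a$ (where $f^n$ is the $n$-th iterate), and the parent of a vertex $x$ of level $n+1$ is $f(x)$. Let $G_\infty(F,f,a)\le \mathrm{Aut}\,T_a$ be the image of the natural action of $\mathrm{Gal}(F^{\mathrm{sep}}/F)$ on $T_a$. Write $G_\infty(\mathbb{Q},f,t)$ for this group when $F=\mathbb{Q}(t)$ and $a=t$ is transcendental over $\mathbb{Q}$, and $G_\infty(\mathbb{Q},f,\alpha)$ when $F=\mathbb{Q}$ and $a=\alpha\in\mathbb{Q}$. For a subgroup $G$ of $\mathrm{Aut}\,T_a$, let $\pi_n(G)$ be the permutation group that $G$ induces on level $n$, and let $$\mathrm{FPP}(G)=\lim_{n\to\infty}\frac{\#\{g\in\pi_n(G) : g\text{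 fixes some vertex of level }n\}}{|\pi_n(G)|}$$ be its fixed-point proportion. Then the limit defining $\mathrm{FPP}(G_\infty(\mathbb{Q},f,t))$ exists and $$\mathrm{FPP}(G_\infty(\mathbb{Q},f,t))\ \ge\ \prod_{p\mid d}\frac{p-2}{p-1}\ >\ 0,$$ where $p$ runs over the primes dividing $d$. Furthermore, for every $\alpha\in\mathbb{Q}$ that is not strictly post-critical, i.e. $\alpha\ne f^n(c)$ for all $n\ge 1$, where $c$ is the critical point of $f$, the limit defining $\mathrm{FPP}(G_\infty(\mathbb{Q},f,\alpha))$ exists and $$\mathrm{FPP}(G_\infty(\mathbb{Q},f,\alpha))\ \ge\ \prod_{p\mid d}\frac{p-2}{p-1}\ >\ 0.$$ -/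

import Mathlib

open Polynomial Filter Topology

/-- A tree graded by levels: the vertices at each level, and the parent of every vertex at
level `n + 1`. (It is rooted when level `0` is a single vertex.) -/
structure LevelTree where
  /-- the vertices at level `n` -/
  V : ℕ → Type*
  /-- the parent of a vertex at level `n + 1` -/
  parent : ∀ n, V (n + 1) → V n

namespace LevelTree

/-- The group of automorphisms of a tree: families of permutations of the levels that are
compatible with the parent maps. -/
def Aut (T : LevelTree) : Subgroup (∀ n, Equiv.Perm (T.V n)) where
  carrier := {g | ∀ n v, T.parent n (g (n + 1) v) = g n (T.parent n v)}
  one_mem' := fun _ _ => rfl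
  mul_mem' := by
    intro g h hg hh n v
    simp only [Pi.mul_apply, Equiv.Perm.mul_apply]
    rw [hg, hh]
  inv_mem' := by
    intro g hg n v
    simp only [Pi.inv_apply]
    rw [Equiv.Perm.eq_inv_iff_eq, ← hg]
    simp

/-- The action of `Aut T` on the `n`-th level. -/
def levelHom (T : LevelTree) (n : ℕ) : T.Aut →* Equiv.Perm (T.V n) :=
  (Pi.evalMonoidHom (fun n => Equiv.Perm (T.V n)) n).comp T.Aut.subtype

/-- `π_n(G)`: the permutation group that `G ≤ Aut T` induces on the `n`-th level. -/
def levelGroup {T : LevelTree} (G : Subgroup T.Aut) (n : ℕ) : Subgroup (Equiv.Perm (T.V n)) :=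
  G.map (T.levelHom n)

/-- The proportion of elements of `π_n(G)` that fix some vertex at level `n`. -/
noncomputable def fixedProportion {T : LevelTree} (G : Subgroup T.Aut) (n : ℕ) : ℝ :=
  (Nat.card {g : levelGroup G n // ∃ v : T.V n, (g : Equiv.Perm (T.V n)) v = v} : ℝ) /
    (Nat.card (levelGroup G n) : ℝ)

/-- The fixed-point proportion `FPP(G)`, the limit of the level proportions. -/
noncomputable def FPP {T : LevelTree} (G : Subgroup T.Aut) : ℝ :=
  limUnder atTop (fixedProportion G)

end LevelTree

section Arboreal

/-- The tree `⨆ₙ f⁻ⁿ(a)` of iterated preimages of `a ∈ F` in a separable closure of `F`: the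
vertices at level `n` are the solutions `x` of `fⁿ(x) = a`, and the parent of `x` is `f(x)`. -/
noncomputable def preimageTree {F : Type*} [Field F] (f : F[X]) (a : F) : LevelTree where
  V n := {x : SeparableClosure F //
    (fun y : SeparableClosure F => aeval y f)^[n] x = algebraMap F (SeparableClosure F) a}
  parent _ x := ⟨aeval x.1 f, x.2⟩

theorem galois_iterate {F : Type*} [Field F] (f : F[X])
    (σ : SeparableClosure F ≃ₐ[F] SeparableClosure F) (n : ℕ) (x : SeparableClosure F) :
    (fun y : SeparableClosure F => aeval y f)^[n] (σ x) =
      σ ((fun y : SeparableClosure F => aeval y f)^[n] x) := by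
  induction n generalizing x with
  | zero => rfl
  | succ n ih =>
    rw [Function.iterate_succ_apply, Function.iterate_succ_apply, ← ih]
    congr 1
    exact aeval_algHom_apply σ.toAlgHom x f

/-- The arboreal Galois representation: the action of the absolute Galois group of `F` on the
tree of iterated preimages of `a`. -/
noncomputable def arborealRep {F : Type*} [Field F] (f : F[X]) (a : F) :
    (SeparableClosure F ≃ₐ[F] SeparableClosure F) →* (preimageTree f a).Aut where
  toFun σ := ⟨fun n => σ.toEquiv.subtypeEquiv fun x => by
      change _ ↔ (fun y : SeparableClosure F => aeval y f)^[n] (σ x) = _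
      rw [galois_iterate, ← σ.commutes a, σ.injective.eq_iff, σ.commutes],
    fun _ x => Subtype.ext (aeval_algHom_apply σ.toAlgHom x.1 f)⟩
  map_one' := rfl
  map_mul' _ _ := rfl

/-- The image of the arboreal Galois representation of `f` over `F` with base point `a`,
a subgroup of the automorphism group of the tree of iterated preimages of `a`. For `F = K`,
`a = α` this is `G_∞(K, f, α)`. -/
noncomputable def arborealGroup {F : Type*} [Field F] (f : F[X]) (a : F) :
    Subgroup (preimageTree f a).Aut :=
  (arborealRep f a).range

/-- The arithmetic iterated Galois group `G_∞(K, f, t)` of `f ∈ K[z]`: the base field is the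
rational function field `K(t)` and the base point is its variable `t`. -/
noncomputable def arithmeticGaloisGroup {K : Type*} [Field K] (f : K[X]) :
    Subgroup (preimageTree (f.map (algebraMap K (RatFunc K))) (RatFunc.X : RatFunc K)).Aut :=
  arborealGroup (f.map (algebraMap K (RatFunc K))) (RatFunc.X : RatFunc K)

end Arboreal

/-- The (finite) critical points of `f`, in an algebraic closure of `K`. -/
def criticalPoints {K : Type*} [Field K] (f : K[X]) : Set (AlgebraicClosure K) :=
  {c | aeval c (derivative f) = 0}

/-- `f` is unicritical if it has exactly one critical point. -/
def IsUnicritical {K : Type*} [Field K] (f : K[X]) : Prop :=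
  ∃! c : AlgebraicClosure K, c ∈ criticalPoints f

/-- `α` is strictly post-critical if `α = fⁿ(c)` for some critical point `c` and some `n ≥ 1`. -/
def IsStrictlyPostcritical {K : Type*} [Field K] (f : K[X]) (α : K) : Prop :=
  ∃ n : ℕ, 1 ≤ n ∧ ∃ c ∈ criticalPoints f,
    (fun y : AlgebraicClosure K => aeval y f)^[n] c = algebraMap K (AlgebraicClosure K) α

/-! Being unicritical, `f` is `a (X - c) ^ d + b`, so a fibre of `f` is `c + ζ ^ j * z` with `ζ` a
primitive `d`-th root of unity. If `σ` sends `ζ` to `ζ ^ u` and fixes the base `y`, then `σ z = ζ ^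
k * z`, and the point with index `j` is fixed as soon as `u * j + k = j` modulo `d`. This is
solvable when `u - 1` is a unit, so such a `σ` fixes a vertex at every level
(`exists_fixed_vertex`). It remains to count. The `d`-th cyclotomic polynomial is irreducible over
`ℚ` and `ℚ(t)`, so every unit `u` occurs, and by the Chinese remainder theorem those with `u ≠ 1`
modulo each `p ∣ d` have proportion `∏ (p - 2) / (p - 1)`. The count descends to `π_n(G)`, `n ≥ 1`,
because the action on level `n` determines `u` when the root is not `b`
(`autToPow_eq_one_of_trivial_on_level`). -/

/-! ### Proportions in quotients of a group -/

section Counting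

variable {A G H : Type*} [Group A] [Group G] [Group H]

/-- A surjective homomorphism of groups is, over any set, a trivial bundle with fibre the
kernel. -/
noncomputable def MonoidHom.preimageEquivProdKer (φ : G →* H) (hφ : Function.Surjective φ)
    (S : Set H) : (φ ⁻¹' S : Set G) ≃ S × φ.ker where
  toFun g := (⟨φ g.1, g.2⟩, ⟨(Function.surjInv hφ (φ g.1))⁻¹ * g.1, by
    simp [MonoidHom.mem_ker, Function.surjInv_eq hφ]⟩)
  invFun x := ⟨Function.surjInv hφ x.1.1 * x.2.1, by
    have := x.2.2
    rw [MonoidHom.mem_ker] at this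
    simp [Function.surjInv_eq hφ, this]⟩
  left_inv g := by simp
  right_inv x := by
    have := x.2.2
    rw [MonoidHom.mem_ker] at this
    ext <;> simp [Function.surjInv_eq hφ, this]

theorem MonoidHom.card_preimage_div_card [Finite G] (φ : G →* H) (hφ : Function.Surjective φ)
    (S : Set H) :
    (Nat.card (φ ⁻¹' S : Set G) : ℝ) / Nat.card G = Nat.card S / Nat.card H := by
  have h1 := Nat.card_congr (φ.preimageEquivProdKer hφ S)
  have h2 := Nat.card_congr (φ.preimageEquivProdKer hφ Set.univ)
  rw [Nat.card_prod] at h1 h2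
  rw [Set.preimage_univ, Nat.card_congr (Equiv.Set.univ G),
    Nat.card_congr (Equiv.Set.univ H)] at h2
  have hk : (Nat.card φ.ker : ℝ) ≠ 0 := Nat.cast_ne_zero.2 Nat.card_pos.ne'
  rw [h1, h2]
  push_cast
  exact mul_div_mul_right _ _ hk

theorem MonoidHom.exists_factor (ρ : A →* G) (τ : A →* H)
    (hρ : Function.Surjective ρ) (hτ : Function.Surjective τ) (hker : ρ.ker ≤ τ.ker) :
    ∃ φ : G →* H, Function.Surjective φ ∧ ∀ a, φ (ρ a) = τ a := by
  refine ⟨ρ.liftOfSurjective hρ ⟨τ, hker⟩, fun h => ?_, fun a => ?_⟩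
  · obtain ⟨a, rfl⟩ := hτ h
    exact ⟨ρ a, ρ.liftOfRightInverse_comp_apply _ _ ⟨τ, hker⟩ a⟩
  · exact ρ.liftOfRightInverse_comp_apply _ _ ⟨τ, hker⟩ a

theorem MonoidHom.proportion_le_of_factor [Finite G] (ρ : A →* G) (τ : A →* H)
    (hρ : Function.Surjective ρ) (hτ : Function.Surjective τ) (hker : ρ.ker ≤ τ.ker)
    {S : Set G} {T : Set H} (hST : ∀ a, ρ a ∈ S → τ a ∈ T) :
    (Nat.card S : ℝ) / Nat.card G ≤ Nat.card T / Nat.card H := by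
  obtain ⟨φ, hφ, h⟩ := ρ.exists_factor τ hρ hτ hker
  rw [← φ.card_preimage_div_card hφ]
  gcongr
  refine Nat.card_mono (Set.toFinite _) fun g hg => ?_
  obtain ⟨a, rfl⟩ := hρ g
  simpa [h] using hST a hg

/-- The kernel condition makes `H` a quotient of `G`, and proportions are unchanged under preimage.
In the application `A` is an absolute Galois group, `ρ` its action on a level and `τ` its action on
roots of unity. -/
theorem MonoidHom.le_proportion_of_factor [Finite G] (ρ : A →* G) (τ : A →* H)
    (hρ : Function.Surjective ρ) (hτ : Function.Surjective τ) (hker : ρ.ker ≤ τ.ker)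
    {S : Set G} {T : Set H} (hST : ∀ a, τ a ∈ T → ρ a ∈ S) :
    (Nat.card T : ℝ) / Nat.card H ≤ Nat.card S / Nat.card G := by
  obtain ⟨φ, hφ, h⟩ := ρ.exists_factor τ hρ hτ hker
  rw [← φ.card_preimage_div_card hφ]
  gcongr
  refine Nat.card_mono (Set.toFinite _) fun g hg => ?_
  obtain ⟨a, rfl⟩ := hρ g
  exact hST a (by simpa [h] using hg)

end Counting

/-! ### Existence of the limit -/

namespace LevelTree

variable {T : LevelTree}

/-- The parent of a fixed vertex is fixed, and the action on a level determines the action on the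
level below. -/
theorem fixedProportion_succ_le (G : Subgroup T.Aut) (n : ℕ) [Finite (T.V (n + 1))]
    (hsurj : Function.Surjective (T.parent n)) :
    fixedProportion G (n + 1) ≤ fixedProportion G n := by
  refine MonoidHom.proportion_le_of_factor
    ((T.levelHom (n + 1)).subgroupMap G) ((T.levelHom n).subgroupMap G)
    (MonoidHom.subgroupMap_surjective _ _) (MonoidHom.subgroupMap_surjective _ _) ?_
    (S := {g | ∃ v, (g : Equiv.Perm (T.V (n + 1))) v = v})
    (T := {g | ∃ v, (g : Equiv.Perm (T.V n)) v = v}) ?_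
  · intro g hg
    rw [MonoidHom.mem_ker, Subtype.ext_iff] at hg ⊢
    refine Equiv.ext fun v => ?_
    obtain ⟨w, rfl⟩ := hsurj v
    have hw : g.1.1 (n + 1) w = w := Equiv.congr_fun hg w
    have := g.1.2 n w
    rw [hw] at this
    exact this.symm
  · rintro g ⟨w, hw⟩
    refine ⟨T.parent n w, ?_⟩
    have hw' : g.1.1 (n + 1) w = w := hw
    have := g.1.2 n w
    rw [hw'] at this
    exact this.symm

theorem tendsto_fixedProportion (G : Subgroup T.Aut) (hfin : ∀ n, Finite (T.V n))
    (hsurj : ∀ n, Function.Surjective (T.parent n)) :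
    Tendsto (fixedProportion G) atTop (𝓝 (FPP G)) := by
  have hanti : Antitone (fixedProportion G) :=
    antitone_nat_of_succ_le fun n => fixedProportion_succ_le G n (hsurj n)
  have hbdd : BddBelow (Set.range (fixedProportion G)) :=
    ⟨0, by rintro _ ⟨n, rfl⟩; unfold fixedProportion; positivity⟩
  exact tendsto_nhds_limUnder ⟨_, tendsto_atTop_ciInf hanti hbdd⟩

end LevelTree

/-! ### Counting units `u` modulo `d` with `u - 1` a unit -/

section Units

/-- Reduction of the units modulo `d` to the units modulo every prime divisor of `d`. -/
def unitsToPrimes (d : ℕ) : (ZMod d)ˣ →* ∀ p : d.primeFactors, (ZMod (p : ℕ))ˣ :=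
  MonoidHom.pi fun p => ZMod.unitsMap (Nat.dvd_of_mem_primeFactors p.2)

theorem unitsToPrimes_surjective (d : ℕ) [NeZero d] : Function.Surjective (unitsToPrimes d) := by
  intro u
  have hcop : Pairwise (Function.onFun Nat.Coprime fun p : d.primeFactors => (p : ℕ)) :=
    fun p q hpq => (Nat.coprime_primes (Nat.prime_of_mem_primeFactors p.2)
      (Nat.prime_of_mem_primeFactors q.2)).2 fun h => hpq (Subtype.ext h)
  have hdvd : ∏ p : d.primeFactors, (p : ℕ) ∣ d := by
    rw [Finset.prod_coe_sort d.primeFactors fun p => p]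
    exact Nat.prod_primeFactors_dvd d
  let e := Units.mapEquiv (ZMod.prodEquivPi _ hcop).toMulEquiv
  obtain ⟨v, hv⟩ := ZMod.unitsMap_surjective hdvd (e.symm (MulEquiv.piUnits.symm u))
  refine ⟨v, ?_⟩
  have hw : MulEquiv.piUnits (e (ZMod.unitsMap hdvd v)) = u := by
    rw [hv, e.apply_symm_apply, MulEquiv.apply_symm_apply]
  rw [← hw]
  funext p
  have hp := Finset.dvd_prod_of_mem (fun p : d.primeFactors => (p : ℕ)) (Finset.mem_univ p)
  -- Both sides are ring homomorphisms out of `ZMod d`, hence equal.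
  have key : (Pi.evalRingHom _ p).comp ((ZMod.prodEquivPi _ hcop).toRingHom.comp
      (ZMod.castHom hdvd (ZMod (∏ p : d.primeFactors, (p : ℕ))))) =
      ZMod.castHom (Nat.dvd_of_mem_primeFactors p.2) (ZMod (p : ℕ)) :=
    RingHom.ext_zmod _ _
  exact Units.ext (RingHom.congr_fun key (v : ZMod d)).symm

theorem card_units_ne_one_div (d : ℕ) :
    (Nat.card {u : ∀ p : d.primeFactors, (ZMod (p : ℕ))ˣ | ∀ p, u p ≠ 1} : ℝ) /
      Nat.card (∀ p : d.primeFactors, (ZMod (p : ℕ))ˣ) =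
    ∏ p ∈ d.primeFactors, ((p : ℝ) - 2) / ((p : ℝ) - 1) := by
  have hp (p : d.primeFactors) : Fact (p : ℕ).Prime := ⟨Nat.prime_of_mem_primeFactors p.2⟩
  let e : {u : ∀ p : d.primeFactors, (ZMod (p : ℕ))ˣ | ∀ p, u p ≠ 1} ≃
      ∀ p : d.primeFactors, {u : (ZMod (p : ℕ))ˣ // u ≠ 1} :=
    Equiv.subtypePiEquivPi (p := fun (p : d.primeFactors) (u : (ZMod (p : ℕ))ˣ) => u ≠ 1)
  rw [Nat.card_congr e, Nat.card_pi, Nat.card_pi, Nat.cast_prod, Nat.cast_prod,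
    ← Finset.prod_div_distrib,
    ← Finset.prod_coe_sort d.primeFactors fun p => ((p : ℝ) - 2) / ((p : ℝ) - 1)]
  refine Finset.prod_congr rfl fun p _ => ?_
  have h2 := (hp p).out.two_le
  have hu : Nat.card (ZMod (p : ℕ))ˣ = p - 1 := by
    rw [Nat.card_eq_fintype_card, ZMod.card_units]
  have hn : Nat.card {u : (ZMod (p : ℕ))ˣ // u ≠ 1} = p - 2 := by
    classical
    rw [Nat.card_eq_fintype_card, Fintype.card_subtype_compl, Fintype.card_subtype_eq,
      ZMod.card_units]
    omega
  rw [hu, hn, Nat.cast_sub h2, Nat.cast_sub (by omega)]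
  norm_num

theorem isUnit_sub_one_of_unitsToPrimes {d : ℕ} [NeZero d] {u : (ZMod d)ˣ}
    (hu : ∀ p, unitsToPrimes d u p ≠ 1) : IsUnit ((u : ZMod d) - 1) := by
  obtain ⟨m, hm⟩ := ZMod.natCast_zmod_surjective ((u : ZMod d) - 1)
  rw [← hm, ZMod.isUnit_iff_coprime]
  refine Nat.Coprime.symm (Nat.coprime_of_dvd fun p hp hpd hpm => ?_)
  have hmem : p ∈ d.primeFactors := Nat.mem_primeFactors.2 ⟨hp, hpd, NeZero.ne d⟩
  refine hu ⟨p, hmem⟩ (Units.ext ?_)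
  change ZMod.castHom hpd (ZMod p) (u : ZMod d) = 1
  have : ZMod.castHom hpd (ZMod p) ((u : ZMod d) - 1) = 0 := by
    rw [← hm, map_natCast, (ZMod.natCast_eq_zero_iff m p).2 hpm]
  rwa [map_sub, map_one, sub_eq_zero] at this

theorem prod_sub_two_div_pos {d : ℕ} (hodd : Odd d) :
    0 < ∏ p ∈ d.primeFactors, ((p : ℝ) - 2) / ((p : ℝ) - 1) := by
  refine Finset.prod_pos fun p hp => ?_
  have hpp := Nat.prime_of_mem_primeFactors hp
  -- Oddness excludes `p = 2`, whose factor would vanish.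
  have h3 : 2 < p := by
    refine lt_of_le_of_ne hpp.two_le fun h => ?_
    exact (Nat.not_even_iff_odd.2 hodd) (even_iff_two_dvd.2 (h ▸ Nat.dvd_of_mem_primeFactors hp))
  have : (2 : ℝ) < p := by exact_mod_cast h3
  exact div_pos (by linarith) (by linarith)

end Units

/-! ### Surjectivity of the cyclotomic character -/

section Cyclotomic

theorem irreducible_cyclotomic_ratFunc {K : Type*} [Field K] {d : ℕ}
    (hirr : Irreducible (cyclotomic d K)) :
    Irreducible (cyclotomic d (RatFunc K)) := by
  -- Specialising the variable to `0` gives back the polynomial over `K`; Gauss's lemma then passes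
  -- to `RatFunc K`.
  have h : Irreducible (cyclotomic d K[X]) := by
    refine (cyclotomic.monic d K[X]).irreducible_of_irreducible_map (evalRingHom 0) _ ?_
    rw [map_cyclotomic]
    exact hirr
  have := ((cyclotomic.monic d K[X]).irreducible_iff_irreducible_map_fraction_map
    (K := RatFunc K)).1 h
  rwa [map_cyclotomic] at this

theorem IsPrimitiveRoot.pow_eq_pow_iff_natCast_eq {L : Type*} [CommMonoid L] {d : ℕ} [NeZero d]
    {ζ : L} (hζ : IsPrimitiveRoot ζ d) {m n : ℕ} : ζ ^ m = ζ ^ n ↔ (m : ZMod d) = n := by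
  rw [ZMod.natCast_eq_natCast_iff, (hζ.isOfFinOrder (NeZero.ne d)).pow_eq_pow_iff_modEq,
    ← hζ.eq_orderOf]

/-- All primitive `d`-th roots of unity share the minimal polynomial `cyclotomic d F`, so they are
conjugate. -/
theorem autToPow_surjective {F L : Type*} [Field F] [Field L] [Algebra F L] [Normal F L]
    {d : ℕ} [NeZero d] {ζ : L} (hζ : IsPrimitiveRoot ζ d)
    (hirr : Irreducible (cyclotomic d F)) : Function.Surjective (hζ.autToPow F) := by
  intro u
  have hmin : minpoly F ζ = cyclotomic d F := by
    refine (minpoly.eq_of_irreducible_of_monic hirr ?_ (cyclotomic.monic d F)).symm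
    rw [aeval_def, eval₂_eq_eval_map, map_cyclotomic]
    have : NeZero (d : L) := hζ.neZero'
    exact hζ.isRoot_cyclotomic (NeZero.pos d)
  have hroot : aeval (ζ ^ (u : ZMod d).val) (minpoly F ζ) = 0 := by
    rw [hmin, aeval_def, eval₂_eq_eval_map, map_cyclotomic]
    have : NeZero (d : L) := hζ.neZero'
    exact (hζ.pow_of_coprime _ (ZMod.val_coe_unit_coprime u)).isRoot_cyclotomic (NeZero.pos d)
  obtain ⟨σ, hσ⟩ := minpoly.exists_algEquiv_of_root'
    (Normal.isIntegral (F := F) inferInstance ζ).isAlgebraic hroot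
  refine ⟨σ, Units.ext ?_⟩
  have h := hζ.autToPow_spec F σ
  rw [hσ] at h
  have := hζ.pow_inj (ZMod.val_lt _) (ZMod.val_lt _) h
  exact ZMod.val_injective _ this

end Cyclotomic

/-! ### Unicritical polynomials and their preimage trees -/

section Unicritical

/-- The critical point of a unicritical polynomial over `K` is `K`-rational. -/
theorem IsUnicritical.exists_eq {K : Type*} [Field K] [CharZero K] {f : K[X]} (hf : IsUnicritical f) (hd : 1 ≤ f.natDegree) :
    ∃ a b c : K, a ≠ 0 ∧ f = C a * (X - C c) ^ f.natDegree + C b := by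
  obtain ⟨c₀, hc₀, huniq⟩ := hf
  obtain ⟨c, rfl⟩ : ∃ c : K, algebraMap K (AlgebraicClosure K) c = c₀ := by
    -- Conjugates of a critical point are critical, so uniqueness makes it Galois-fixed.
    refine (InfiniteGalois.mem_range_algebraMap_iff_fixed (k := K) c₀).2 fun σ => huniq _ ?_
    have := aeval_algHom_apply (AlgEquiv.toAlgHom σ) c₀ (derivative f)
    rw [show aeval c₀ (derivative f) = 0 from hc₀, map_zero] at this
    exact this
  have hdeg : (derivative f).natDegree = f.natDegree - 1 := natDegree_derivative f
  have hf' : derivative f =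
      C (derivative f).leadingCoeff * (X - C c) ^ (f.natDegree - 1) := by
    have hs := IsAlgClosed.splits ((derivative f).map (algebraMap K (AlgebraicClosure K)))
    have hroots : ((derivative f).map (algebraMap K (AlgebraicClosure K))).roots =
        Multiset.replicate (f.natDegree - 1) (algebraMap K (AlgebraicClosure K) c) := by
      refine Multiset.eq_replicate.2 ⟨?_, fun x hx => huniq x ?_⟩
      · rw [← hs.natDegree_eq_card_roots, natDegree_map, hdeg]
      · have := isRoot_of_mem_roots hx
        rwa [IsRoot.def, eval_map_algebraMap] at this
    apply map_injective _ (algebraMap K (AlgebraicClosure K)).injective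
    conv_lhs => rw [hs.eq_prod_roots, hroots]
    simp
  have hlead : (derivative f).leadingCoeff = f.leadingCoeff * f.natDegree := by
    rw [leadingCoeff, hdeg, coeff_derivative, Nat.sub_add_cancel hd, coeff_natDegree,
      Nat.cast_sub hd]
    simp
  have hder : derivative (f - C f.leadingCoeff * (X - C c) ^ f.natDegree) = 0 := by
    rw [derivative_sub, derivative_C_mul, derivative_X_sub_C_pow, hf', hlead]
    simp only [map_mul, map_natCast]
    ring
  refine ⟨f.leadingCoeff, (f - C f.leadingCoeff * (X - C c) ^ f.natDegree).coeff 0, c,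
    leadingCoeff_ne_zero.2 (by rintro rfl; simp at hd), ?_⟩
  rw [← eq_C_of_natDegree_eq_zero (derivative_eq_zero.1 hder)]
  ring

theorem ne_of_not_isStrictlyPostcritical {K : Type*} [Field K] {a b c α : K} {d : ℕ} (hd : 2 ≤ d)
    (h : ¬ IsStrictlyPostcritical (C a * (X - C c) ^ d + C b) α) : α ≠ b := by
  rintro rfl
  -- The critical value is `b = f(c)`.
  refine h ⟨1, le_rfl, algebraMap K _ c, ?_, ?_⟩
  · change aeval _ (derivative _) = 0
    simp [derivative_X_sub_C_pow, show d - 1 ≠ 0 by omega]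
  · simp [show d ≠ 0 by omega]

variable {F : Type*} [Field F] {a b c : F} {d : ℕ}

theorem exists_aeval_eq_of_isAlgClosed {L : Type*} [Field L] [Algebra F L] [IsAlgClosed L]
    (f : F[X])
    (hf : 0 < f.natDegree) (y : L) : ∃ x : L, aeval x f = y := by
  have hdeg : (f.map (algebraMap F L) - C y).degree ≠ 0 := by
    refine (natDegree_pos_iff_degree_pos.1 ?_).ne'
    rwa [natDegree_sub_C, natDegree_map]
  obtain ⟨x, hx⟩ := IsAlgClosed.exists_root _ hdeg
  refine ⟨x, ?_⟩
  simpa [sub_eq_zero] using hx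

theorem finite_preimageTree_level {f : F[X]} (hf : 0 < f.natDegree) (x₀ : F) (n : ℕ) :
    Finite ((preimageTree f x₀).V n) := by
  have hfib (y : SeparableClosure F) : {x : SeparableClosure F | aeval x f = y}.Finite := by
    have hne : f.map (algebraMap F (SeparableClosure F)) - C y ≠ 0 := by
      intro h
      have := congrArg natDegree (sub_eq_zero.1 h)
      rw [natDegree_map, natDegree_C] at this
      omega
    refine (rootSet_finite (f.map (algebraMap F (SeparableClosure F)) - C y)
      (SeparableClosure F)).subset fun x hx => ?_
    rw [mem_rootSet]
    refine ⟨hne, ?_⟩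
    simp only [Set.mem_ofPred_eq] at hx
    simp [hx]
  have key : ∀ n, {x : SeparableClosure F | (fun y : SeparableClosure F => aeval y f)^[n] x =
      algebraMap F (SeparableClosure F) x₀}.Finite := by
    intro n
    induction n with
    | zero => simp
    | succ n ih =>
      refine Set.Finite.subset (ih.biUnion fun y _ => hfib y) fun x hx => ?_
      simp only [Set.mem_ofPred_eq, Set.mem_iUnion]
      exact ⟨aeval x f, hx, rfl⟩
  exact (key n).to_subtype

theorem parent_preimageTree_surjective [CharZero F] {f : F[X]} (hf : 0 < f.natDegree) (x₀ : F) (n : ℕ) :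
    Function.Surjective ((preimageTree f x₀).parent n) := by
  rintro ⟨y, hy⟩
  obtain ⟨x, hx⟩ := exists_aeval_eq_of_isAlgClosed f hf y
  exact ⟨⟨x, by rw [Function.iterate_succ_apply]; simpa [hx] using hy⟩, Subtype.ext hx⟩

/-- An automorphism acting on the `d`-th roots of unity through a character value `u` with
`u - 1` a unit fixes a point above every fixed value of `a (x - c) ^ d + b`. -/
theorem exists_fixed_preimage [NeZero d] {L : Type*} [Field L] [Algebra F L] [IsAlgClosed L]
    {ζ : L} (hζ : IsPrimitiveRoot ζ d) (ha : a ≠ 0) (σ : L ≃ₐ[F] L)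
    (hσ : IsUnit ((hζ.autToPow F σ : ZMod d) - 1)) {y : L} (hy : σ y = y) :
    ∃ x : L, aeval x (C a * (X - C c) ^ d + C b) = y ∧ σ x = x := by
  have ha' : algebraMap F L a ≠ 0 := by simpa using ha
  set w := (y - algebraMap F L b) / algebraMap F L a with hw
  obtain ⟨z, hz⟩ := IsAlgClosed.exists_pow_nat_eq w (NeZero.pos d)
  suffices h : ∃ j : ℕ, σ (ζ ^ j * z) = ζ ^ j * z by
    obtain ⟨j, hj⟩ := h
    refine ⟨ζ ^ j * z + algebraMap F L c, ?_, ?_⟩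
    · simp only [map_add, map_mul, map_pow, map_sub, aeval_X, aeval_C, add_sub_cancel_right]
      rw [mul_pow, ← pow_mul, mul_comm j, pow_mul, hζ.pow_eq_one, one_pow, one_mul, hz, hw]
      field_simp
      ring
    · rw [map_add, hj, σ.commutes]
  have hσw : σ w = w := by simp [hw, hy]
  obtain ⟨k, hk⟩ : ∃ k : ℕ, σ z = ζ ^ k * z := by
    -- `z = 0` occurs when `y` is the critical value; the fibre is then one point.
    rcases eq_or_ne z 0 with rfl | hz0
    · exact ⟨0, by simp⟩
    · have : (σ z / z) ^ d = 1 := by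
        rw [div_pow, ← map_pow, hz, hσw, div_self]
        rw [← hz]
        exact pow_ne_zero _ hz0
      obtain ⟨k, -, hk⟩ := hζ.eq_pow_of_pow_eq_one this
      exact ⟨k, by rw [hk]; field_simp⟩
  obtain ⟨v, hv⟩ := hσ
  -- With `v = u - 1`, this `j` solves `u * j + k = j`.
  obtain ⟨j, hj⟩ := ZMod.natCast_zmod_surjective (-(k : ZMod d) * ((v⁻¹ : (ZMod d)ˣ) : ZMod d))
  refine ⟨j, ?_⟩
  rw [map_mul, map_pow, hk, ← hζ.autToPow_spec F σ, ← mul_assoc, ← pow_mul, ← pow_add]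
  congr 1
  rw [hζ.pow_eq_pow_iff_natCast_eq]
  push_cast
  rw [ZMod.natCast_zmod_val, hj, eq_add_of_sub_eq hv.symm]
  have := v.mul_inv
  linear_combination (-(k : ZMod d)) * this

theorem exists_fixed_vertex [CharZero F] [NeZero d] {ζ : SeparableClosure F} (hζ : IsPrimitiveRoot ζ d)
    (ha : a ≠ 0) (x₀ : F) (σ : SeparableClosure F ≃ₐ[F] SeparableClosure F)
    (hσ : IsUnit ((hζ.autToPow F σ : ZMod d) - 1)) (n : ℕ) :
    ∃ v : (preimageTree (C a * (X - C c) ^ d + C b) x₀).V n, σ v.1 = v.1 := by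
  induction n with
  | zero => exact ⟨⟨algebraMap F _ x₀, rfl⟩, σ.commutes _⟩
  | succ n ih =>
    obtain ⟨v, hv⟩ := ih
    obtain ⟨x, hx, hσx⟩ := exists_fixed_preimage (b := b) (c := c) hζ ha σ hσ hv
    exact ⟨⟨x, by rw [Function.iterate_succ_apply]; simpa only [hx] using v.2⟩, hσx⟩

/-- An automorphism acting trivially on a level above the root acts trivially on the `d`-th roots
of unity, unless the root is the critical value. -/
theorem autToPow_eq_one_of_trivial_on_level [CharZero F] [NeZero d] {ζ : SeparableClosure F}
    (hζ : IsPrimitiveRoot ζ d) (ha : a ≠ 0) {x₀ : F} (hx₀ : x₀ ≠ b)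
    (σ : SeparableClosure F ≃ₐ[F] SeparableClosure F) (n : ℕ)
    (hσ : ∀ v : (preimageTree (C a * (X - C c) ^ d + C b) x₀).V (n + 1), σ v.1 = v.1) :
    hζ.autToPow F σ = 1 := by
  set f := C a * (X - C c) ^ d + C b with hf
  have hdeg : f.natDegree = d := by
    rw [hf, natDegree_add_C, natDegree_C_mul ha, natDegree_pow, natDegree_X_sub_C, mul_one]
  have hpos : 0 < f.natDegree := hdeg ▸ NeZero.pos d
  induction n with
  | succ n ih =>
    refine ih fun v => ?_
    obtain ⟨w, rfl⟩ := parent_preimageTree_surjective hpos x₀ (n + 1) v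
    change σ (aeval w.1 f) = aeval w.1 f
    have := aeval_algHom_apply σ.toAlgHom w.1 f
    refine this.symm.trans ?_
    exact congrArg (fun y => aeval y f) (hσ w)
  | zero =>
    have ha' : algebraMap F (SeparableClosure F) a ≠ 0 := by simpa using ha
    obtain ⟨z, hz⟩ := IsAlgClosed.exists_pow_nat_eq
      (algebraMap F (SeparableClosure F) ((x₀ - b) / a)) (NeZero.pos d)
    have hz0 : z ≠ 0 := by
      rintro rfl
      rw [zero_pow (NeZero.ne d), eq_comm, map_eq_zero, div_eq_zero_iff, sub_eq_zero] at hz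
      exact hz.elim hx₀ ha
    have hfix (y : SeparableClosure F) (hy : y ^ d = z ^ d) : σ y = y := by
      have h := hσ ⟨y + algebraMap F _ c, by
        rw [zero_add, Function.iterate_one, hf]
        simp only [map_add, map_mul, map_pow, map_sub, aeval_X, aeval_C, add_sub_cancel_right]
        rw [hy, hz, map_div₀, map_sub]
        field_simp
        ring⟩
      simpa using h
    -- Both `z` and `ζ * z` are fixed and `z ≠ 0`, so their ratio `ζ` is fixed.
    have h1 := hfix z rfl
    have h2 := hfix (ζ * z) (by rw [mul_pow, hζ.pow_eq_one, one_mul])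
    rw [map_mul, h1, mul_left_inj' hz0, ← hζ.autToPow_spec F σ] at h2
    refine Units.ext ?_
    have h3 : ζ ^ (hζ.autToPow F σ : ZMod d).val = ζ ^ 1 := by rw [h2, pow_one]
    rw [hζ.pow_eq_pow_iff_natCast_eq, ZMod.natCast_zmod_val] at h3
    simpa using h3

theorem arborealGroup_unicritical [CharZero F] [NeZero d] (hirr : Irreducible (cyclotomic d F)) (ha : a ≠ 0)
    {x₀ : F} (hx₀ : x₀ ≠ b) :
    Tendsto (LevelTree.fixedProportion (arborealGroup (C a * (X - C c) ^ d + C b) x₀)) atTop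
        (𝓝 (LevelTree.FPP (arborealGroup (C a * (X - C c) ^ d + C b) x₀))) ∧
      ∏ p ∈ d.primeFactors, ((p : ℝ) - 2) / ((p : ℝ) - 1)
        ≤ LevelTree.FPP (arborealGroup (C a * (X - C c) ^ d + C b) x₀) := by
  set f := C a * (X - C c) ^ d + C b with hf
  have hdeg : f.natDegree = d := by
    rw [hf, natDegree_add_C, natDegree_C_mul ha, natDegree_pow, natDegree_X_sub_C, mul_one]
  have hpos : 0 < f.natDegree := hdeg ▸ NeZero.pos d
  have hfin := finite_preimageTree_level hpos x₀
  have hlim := LevelTree.tendsto_fixedProportion (arborealGroup f x₀) hfin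
    (parent_preimageTree_surjective hpos x₀)
  -- Level `0` is omitted: the action on the root alone does not determine the character.
  refine ⟨hlim, ge_of_tendsto hlim (eventually_atTop.2 ⟨1, fun n hn => ?_⟩)⟩
  obtain ⟨n, rfl⟩ := Nat.exists_eq_add_of_le' hn
  obtain ⟨ζ, hζ⟩ := HasEnoughRootsOfUnity.exists_primitiveRoot (SeparableClosure F) d
  rw [← card_units_ne_one_div]
  refine MonoidHom.le_proportion_of_factor
    ((((preimageTree f x₀).levelHom (n + 1)).subgroupMap (arborealGroup f x₀)).comp
      (arborealRep f x₀).rangeRestrict)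
    ((unitsToPrimes d).comp (hζ.autToPow F)) ?_ ?_ ?_
    (S := {g | ∃ v, (g : Equiv.Perm ((preimageTree f x₀).V (n + 1))) v = v}) ?_
  · exact (MonoidHom.subgroupMap_surjective _ _).comp (MonoidHom.rangeRestrict_surjective _)
  · exact (unitsToPrimes_surjective d).comp (autToPow_surjective hζ hirr)
  · intro σ hσ
    rw [MonoidHom.mem_ker, Subtype.ext_iff] at hσ
    rw [MonoidHom.mem_ker, MonoidHom.comp_apply,
      autToPow_eq_one_of_trivial_on_level hζ ha hx₀ σ n fun v =>
        congrArg Subtype.val (Equiv.congr_fun hσ v), map_one]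
  · intro σ hσ
    obtain ⟨v, hv⟩ := exists_fixed_vertex (b := b) (c := c) hζ ha x₀ σ
      (isUnit_sub_one_of_unitsToPrimes hσ) (n + 1)
    exact ⟨v, Subtype.ext hv⟩

theorem arithmeticGaloisGroup_unicritical [CharZero F] [NeZero d]
    (hirr : Irreducible (cyclotomic d F)) (ha : a ≠ 0) :
    Tendsto (LevelTree.fixedProportion (arithmeticGaloisGroup (C a * (X - C c) ^ d + C b))) atTop
        (𝓝 (LevelTree.FPP (arithmeticGaloisGroup (C a * (X - C c) ^ d + C b)))) ∧
      ∏ p ∈ d.primeFactors, ((p : ℝ) - 2) / ((p : ℝ) - 1)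
        ≤ LevelTree.FPP (arithmeticGaloisGroup (C a * (X - C c) ^ d + C b)) := by
  have : CharZero (RatFunc F) :=
    charZero_of_injective_algebraMap (algebraMap F (RatFunc F)).injective
  have hmap : (C a * (X - C c) ^ d + C b).map (algebraMap F (RatFunc F)) =
      C (algebraMap F (RatFunc F) a) * (X - C (algebraMap F (RatFunc F) c)) ^ d +
        C (algebraMap F (RatFunc F) b) := by
    simp only [Polynomial.map_add, Polynomial.map_mul, Polynomial.map_pow, Polynomial.map_sub,
      map_C, map_X]
  have hX : (RatFunc.X : RatFunc F) ≠ algebraMap F (RatFunc F) b := by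
    intro h
    rw [← RatFunc.algebraMap_X, IsScalarTower.algebraMap_apply F F[X] (RatFunc F)] at h
    exact X_ne_C b (IsFractionRing.injective F[X] (RatFunc F) h)
  rw [arithmeticGaloisGroup, hmap]
  exact arborealGroup_unicritical (irreducible_cyclotomic_ratFunc hirr)
    ((map_ne_zero (algebraMap F (RatFunc F))).2 ha) hX

end Unicritical

theorem corollary2 (f : ℚ[X]) (d : ℕ) (hdeg : f.natDegree = d) (hodd : Odd d) (hd : 3 ≤ d)
    (hf : IsUnicritical f) :
    0 < ∏ p ∈ d.primeFactors, ((p : ℝ) - 2) / ((p : ℝ) - 1) ∧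
    (Tendsto (LevelTree.fixedProportion (arithmeticGaloisGroup f)) atTop
        (𝓝 (LevelTree.FPP (arithmeticGaloisGroup f))) ∧
      ∏ p ∈ d.primeFactors, ((p : ℝ) - 2) / ((p : ℝ) - 1)
        ≤ LevelTree.FPP (arithmeticGaloisGroup f)) ∧
    (∀ α : ℚ, ¬ IsStrictlyPostcritical f α →
      Tendsto (LevelTree.fixedProportion (arborealGroup f α)) atTop
        (𝓝 (LevelTree.FPP (arborealGroup f α))) ∧
      ∏ p ∈ d.primeFactors, ((p : ℝ) - 2) / ((p : ℝ) - 1)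
        ≤ LevelTree.FPP (arborealGroup f α)) := by
  subst hdeg
  have : NeZero f.natDegree := ⟨by omega⟩
  obtain ⟨a, b, c, ha, hfeq⟩ := hf.exists_eq (by omega)
  generalize f.natDegree = d at *
  subst hfeq
  refine ⟨prod_sub_two_div_pos hodd, ?_, fun α hα => ?_⟩
  · exact arithmeticGaloisGroup_unicritical (cyclotomic.irreducible_rat (NeZero.pos d)) ha
  · exact arborealGroup_unicritical (cyclotomic.irreducible_rat (NeZero.pos d)) ha
      (ne_of_not_isStrictlyPostcritical (d := d) (by omega) hα)
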